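/- A pattern of length $k\ge 1$ is a permutation $\pi=\pi(1)\cdots\pi(k)$ of $\{1,\dots,k\}$. A rooted forest on $[n]=\{1,\dots,n\}$ is a forest with vertex set $[n]$ (each vertex being its own label) in which every connected component has a distinguished vertex, its root; $u$ is an ancestor of $v$ if $u$ lies on the path from the root of the component of $v$ to $v$. A rooted forest contains $\pi$ if there are vertices $v_1,\dots,v_k$ such that $v_i$ is an ancestor of $v_{i+1}$ for $1\le i<k$ and the labels of $v_1,\dots,v_k$ are in the same relative order as $\pi(1),\dots,\pi(k)$; it avoids a set $S$ of patterns if it contains no $\pi\in S$. Let $f_n(S)$ be the number of rooted forests on $[n]$ avoiding $S$. The set $S$ is called covered if it contains a pattern whose first letter is its smallest letter and a (not necessarily different) pattern whose first letter is its largest letter, and uncovered otherwise; in particular a set containing the one-letter pattern $1$ is covered. **Proposition 4.7.** Let $S$ be an uncovered set of patterns (finite or infinite, possibly empty). Then the limit $$L_S=\lim_{n\to\infty}\frac{f_n(S)^{1/n}}{n}$$ exists in $\mathbb R$, and $L_S=e^{-1}$ if and only if $12\in S$ or $21\in S$. If $S$ contains neither $12$ nor $21$, then $L_S>e^{-1}$.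 -/

import Mathlib

open Filter Topology

/-- A pattern `π = π(1)⋯π(k)`: a permutation of `k` letters, `k ≥ 1`.
Positions and values are counted from `0`. -/
structure Pattern where
  length : ℕ
  length_pos : 0 < length
  perm : Equiv.Perm (Fin length)

namespace Pattern

/-- The first letter `π(1)` of a pattern, counted from `0`. -/
def first (π : Pattern) : Fin π.length := π.perm ⟨0, π.length_pos⟩

/-- The pattern begins with its smallest letter. -/
def StartsWithMin (π : Pattern) : Prop := (π.first : ℕ) = 0

/-- The pattern begins with its largest letter. -/
def StartsWithMax (π : Pattern) : Prop := (π.first : ℕ) + 1 = π.length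

/-- The pattern `12`. -/
def p12 : Pattern := ⟨2, Nat.two_pos, Equiv.refl (Fin 2)⟩

/-- The pattern `21`. -/
def p21 : Pattern := ⟨2, Nat.two_pos, Equiv.swap 0 1⟩

/-- A set of patterns is covered if it contains a pattern beginning with its smallest letter and
a pattern beginning with its largest letter. The one-letter pattern is both at once, so a set
that contains it is covered. -/
def Covered (S : Set Pattern) : Prop :=
  (∃ π ∈ S, π.StartsWithMin) ∧ (∃ σ ∈ S, σ.StartsWithMax)

/-- A set of patterns that is not covered. -/
def Uncovered (S : Set Pattern) : Prop := ¬ Covered S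

end Pattern

/-- A rooted (unordered) forest on a finite vertex set `V`, given by its parent map: the roots are
the vertices `v` with `parent v = none`, the edges join each other vertex to its parent, and no
vertex is reached from itself by going from parents to children. -/
@[ext]
structure RootedForest (V : Type*) where
  parent : V → Option V
  acyclic : ∀ v, ¬ Relation.TransGen (fun a b => parent b = some a) v v

namespace RootedForest

variable {V : Type*}

instance [Finite V] : Finite (RootedForest V) :=
  Finite.of_injective RootedForest.parent fun _ _ h => RootedForest.ext h

/-- `u` is an ancestor of `v`, i.e. `u` lies on the path from the root of the tree of `v` to `v`.
Every vertex is an ancestor of itself. -/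
def IsAncestor (F : RootedForest V) (u v : V) : Prop :=
  Relation.ReflTransGen (fun a b => F.parent b = some a) u v

/-- The forest contains `π`: there are vertices `v 0, …, v (k - 1)`, each an ancestor of
the later ones, whose labels are in the same relative order as `π`. The vertices are identified
with their labels. -/
def Contains [LinearOrder V] (F : RootedForest V) (π : Pattern) : Prop :=
  ∃ v : Fin π.length → V,
    (∀ i j, i < j → F.IsAncestor (v i) (v j)) ∧
    (∀ i j, v i < v j ↔ π.perm i < π.perm j)

/-- The forest contains no pattern of `S`. -/
def Avoids [LinearOrder V] (F : RootedForest V) (S : Set Pattern) : Prop :=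
  ∀ π ∈ S, ¬ F.Contains π

end RootedForest

/-- The number `f_n(S)` of rooted labeled forests on `n` labels that avoid `S`. -/
noncomputable def forestCount (S : Set Pattern) (n : ℕ) : ℕ :=
  Nat.card {F : RootedForest (Fin n) // F.Avoids S}

/-- `L` is the forest Stanley-Wilf limit of `S`: the sequence `f_n(S)^(1/n) / n` converges
to `L`. -/
def IsForestStanleyWilfLimit (S : Set Pattern) (L : ℝ) : Prop :=
  Tendsto (fun n : ℕ => (forestCount S n : ℝ) ^ (1 / (n : ℝ)) / (n : ℝ)) atTop (𝓝 L)

/-! Complementing all labels swaps the two halves of being covered and swaps `12` with `21`, so one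
may assume that no pattern of S begins with its smallest letter. Then a new smallest label can be
made a root above an avoiding forest on any set A of old labels, beside an avoiding forest on the
rest: a chain through this root must begin there, so its pattern begins with its minimum. Hence a_n
= f_n / n! satisfies (n+1) a_{n+1} ≥ Σ a_m a_{n-m} (`sum_forestRatio_le`).

It follows that a_n ≥ 1 and that log a_n is superadditive up to an index shift and a logarithmic
error. With a_n ≤ e^{n+1}, a Fekete argument (`exists_tendsto_div_of_superadditive_log`) gives log
a_n / n → ℓ, and Stirling's formula turns this into L = e^{ℓ-1}.

It remains to decide when ℓ = 0. If 21 ∈ S, labels increase away from the roots, so f_n ≤ n!, a_n =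
1 and ℓ = 0. Otherwise the new smallest label may also hang as a leaf below a one-vertex tree, which
creates only a two-vertex chain of shape 21. These extra forests contribute a further a_n to the
bound for (n+2) a_{n+2}, and this forces exponential growth (`pow_le_forestRatio`), so ℓ > 0. -/

theorem Pattern.startsWithMin_of_eq_bot {V : Type*} [LinearOrder V] {π : Pattern}
    {v : Fin π.length → WithBot V} (hv : ∀ i j, v i < v j ↔ π.perm i < π.perm j)
    (h0 : v ⟨0, π.length_pos⟩ = ⊥) : π.StartsWithMin := by
  by_contra hne
  have h := (hv (π.perm.symm ⟨0, π.length_pos⟩) ⟨0, π.length_pos⟩).2 (by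
    rw [Equiv.apply_symm_apply, Fin.lt_def]
    exact Nat.pos_of_ne_zero hne)
  rw [h0] at h
  exact not_lt_bot h

/-! ### Ranks, relabelling and ancestor chains -/

namespace RootedForest

section Basic

variable {V W : Type*}

theorem exists_rank [Finite V] (F : RootedForest V) :
    ∃ r : V → ℕ, ∀ a b, F.parent b = some a → r a < r b := by
  -- The rank is the number of proper ancestors.
  refine ⟨fun v => Set.ncard {u | Relation.TransGen (fun a b => F.parent b = some a) u v},
    fun a b h => Set.ncard_lt_ncard ⟨fun u hu => Relation.TransGen.tail hu h, fun hs => ?_⟩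
      (Set.toFinite _)⟩
  exact F.acyclic a (hs (Relation.TransGen.single h))

theorem acyclic_of_rank {p : V → Option V} (r : V → ℕ)
    (h : ∀ a b, p b = some a → r a < r b) (v : V) :
    ¬ Relation.TransGen (fun a b => p b = some a) v v := by
  have key : ∀ a b, Relation.TransGen (fun a b => p b = some a) a b → r a < r b := by
    intro a b hab
    induction hab with
    | single h1 => exact h _ _ h1
    | tail _ h1 ih => exact ih.trans (h _ _ h1)
  exact fun hv => (key v v hv).ne rfl

theorem IsAncestor.map {F : RootedForest W} {G : RootedForest V} {e : W → V}
    (h : ∀ a b, F.parent b = some a → G.parent (e b) = some (e a)) {a b : W}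
    (hab : F.IsAncestor a b) : G.IsAncestor (e a) (e b) :=
  Relation.ReflTransGen.lift e (fun a b => h a b) _ _ hab

/-- Transport of a forest along a bijection of the vertex sets. -/
def relabel (e : V ≃ W) (F : RootedForest V) : RootedForest W where
  parent w := (F.parent (e.symm w)).map e
  acyclic w hw := F.acyclic (e.symm w) <| by
    refine Relation.TransGen.lift e.symm (fun a b h => ?_) _ _ hw
    obtain ⟨c, hc, rfl⟩ := Option.map_eq_some_iff.1 h
    simpa [Function.onFun] using hc

theorem relabel_symm_relabel (e : V ≃ W) (F : RootedForest V) :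
    (F.relabel e).relabel e.symm = F := by
  ext1; funext v; simp [relabel]

theorem isAncestor_relabel (e : V ≃ W) (F : RootedForest V) {a b : V} :
    (F.relabel e).IsAncestor (e a) (e b) ↔ F.IsAncestor a b := by
  have key : ∀ {a b}, F.IsAncestor a b → (F.relabel e).IsAncestor (e a) (e b) :=
    IsAncestor.map (fun a b h => by simp [relabel, h])
  refine ⟨fun h => ?_, key⟩
  have := IsAncestor.map (G := F) (e := e.symm) (fun a b h => by
    obtain ⟨c, hc, rfl⟩ := Option.map_eq_some_iff.1 h
    simpa using hc) h
  simpa using this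

theorem contains_relabel_iff [LinearOrder V] [LinearOrder W] (e : V ≃o W) (F : RootedForest V)
    (π : Pattern) : (F.relabel e.toEquiv).Contains π ↔ F.Contains π := by
  constructor
  · rintro ⟨v, h1, h2⟩
    refine ⟨fun i => e.symm (v i), fun i j hij => ?_, fun i j => by simp [h2]⟩
    rw [← isAncestor_relabel e.toEquiv]
    simpa using h1 i j hij
  · rintro ⟨v, h1, h2⟩
    refine ⟨fun i => e (v i), fun i j hij => ?_, fun i j => by simp [h2]⟩
    exact (isAncestor_relabel e.toEquiv F).2 (h1 i j hij)

theorem card_avoids_eq_forestCount (S : Set Pattern) (V : Type*) [LinearOrder V] [Fintype V]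
    {n : ℕ} (hn : Fintype.card V = n) :
    Nat.card {F : RootedForest V // F.Avoids S} = forestCount S n := by
  have e : V ≃o Fin n := (Fintype.orderIsoFinOfCardEq V hn).symm
  refine Nat.card_congr (Equiv.subtypeEquiv
    ⟨relabel e.toEquiv, relabel e.toEquiv.symm, relabel_symm_relabel _, fun F => by
      simpa using relabel_symm_relabel e.toEquiv.symm F⟩ fun F => ?_)
  simp only [Avoids, Equiv.coe_fn_mk]
  exact forall₂_congr fun π _ => not_congr (contains_relabel_iff e F π).symm

/-- Climbing from the image of `F`, one either stays in it, moving along edges of `F`, or enters `P`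
and never leaves. In the uses below, `P` is the new root `⊥` or empty. -/
theorem ancestor_mem {F : RootedForest W} {G : RootedForest V} {e : W → V} {P : V → Prop}
    (hP : ∀ c u, P c → G.parent c = some u → P u)
    (he : ∀ w u, G.parent (e w) = some u → P u ∨ ∃ w', u = e w' ∧ F.parent w = some w')
    {u : V} {w : W} (h : G.IsAncestor u (e w)) : P u ∨ ∃ w', u = e w' ∧ F.IsAncestor w' w := by
  induction h using Relation.ReflTransGen.head_induction_on with
  | refl => exact Or.inr ⟨w, rfl, Relation.ReflTransGen.refl⟩
  | head hab _ ih =>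
    rcases ih with hc | ⟨w', rfl, hw⟩
    · exact Or.inl (hP _ _ hc hab)
    · rcases he _ _ hab with h' | ⟨w'', rfl, hw'⟩
      · exact Or.inl h'
      · exact Or.inr ⟨w'', rfl, Relation.ReflTransGen.head hw' hw⟩

theorem pred_of_isAncestor {G : RootedForest V} {P : V → Prop}
    (hP : ∀ c u, P c → G.parent c = some u → P u) {u c : V} (h : G.IsAncestor u c) (hc : P c) :
    P u := by
  induction h using Relation.ReflTransGen.head_induction_on with
  | refl => exact hc
  | head hab _ ih => exact hP _ _ ih hab

end Basic

variable {V : Type*} [LinearOrder V]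

/-- Chains ending in the image of `F` that realize a pattern not beginning with its smallest
letter stay inside the image. -/
theorem contains_of_last_mem {W : Type*} [LinearOrder W] {F : RootedForest W}
    {G : RootedForest (WithBot V)} {e : W ↪o WithBot V} {P : WithBot V → Prop}
    (hPbot : ∀ c, P c → c = ⊥)
    (hP : ∀ c u, P c → G.parent c = some u → P u)
    (he : ∀ w u, G.parent (e w) = some u → P u ∨ ∃ w', u = e w' ∧ F.parent w = some w')
    {π : Pattern} (hπ : ¬ π.StartsWithMin) {v : Fin π.length → WithBot V}
    (hanc : ∀ i j, i < j → G.IsAncestor (v i) (v j))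
    (hv : ∀ i j, v i < v j ↔ π.perm i < π.perm j) {w : W}
    (hw : v ⟨π.length - 1, Nat.sub_one_lt π.length_pos.ne'⟩ = e w) : F.Contains π := by
  have hanc' : ∀ i j, i ≤ j → G.IsAncestor (v i) (v j) := fun i j hij => by
    rcases hij.eq_or_lt with rfl | h
    · exact Relation.ReflTransGen.refl
    · exact hanc i j h
  -- A chain vertex outside the image lies in `P`, hence so does the first vertex, which is then
  -- `⊥`; the pattern would begin with its minimum.
  have hmem : ∀ i, ∃ w', v i = e w' := fun i => by
    have hi : G.IsAncestor (v i) (e w) := hw ▸ hanc' i _ (Fin.le_def.2 (by simp; omega))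
    rcases ancestor_mem hP he hi with h | ⟨w', h, _⟩
    · refine absurd (Pattern.startsWithMin_of_eq_bot hv (hPbot _ ?_)) hπ
      exact pred_of_isAncestor hP (hanc' ⟨0, π.length_pos⟩ i (Fin.le_def.2 (Nat.zero_le _))) h
    · exact ⟨w', h⟩
  choose x hx using hmem
  refine ⟨x, fun i j hij => ?_, fun i j => ?_⟩
  · have h := hanc i j hij
    rw [hx i, hx j] at h
    rcases ancestor_mem hP he h with h' | ⟨w', h', hw'⟩
    · refine absurd (Pattern.startsWithMin_of_eq_bot hv (hPbot _ ?_)) hπ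
      rw [← hx] at h'
      exact pred_of_isAncestor hP (hanc' ⟨0, π.length_pos⟩ i (Fin.le_def.2 (Nat.zero_le _))) h'
    · rwa [e.injective h']
  · rw [← hv, hx i, hx j, e.lt_iff_lt]

/-- The vertices satisfying `p`, as elements of `WithBot V`. -/
def subtypeBotEmb (p : V → Prop) : {x // p x} ↪o WithBot V :=
  (OrderEmbedding.subtype p).trans WithBot.coeOrderHom

@[simp] theorem subtypeBotEmb_mk (p : V → Prop) (x : V) (h : p x) :
    subtypeBotEmb p ⟨x, h⟩ = (x : WithBot V) := rfl

/-! ### Two ways to insert a new smallest label -/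

section Construct

variable [Finite V]

open Classical in
/-- Glue a forest on `A`, put below a new root `⊥`, and a forest on the complement of `A`. -/
noncomputable def joinBot (A : Finset V) (F₁ : RootedForest {x // x ∈ A})
    (F₂ : RootedForest {x // x ∉ A}) : RootedForest (WithBot V) where
  parent := WithBot.recBotCoe none fun x =>
    if h : x ∈ A then some ((F₁.parent ⟨x, h⟩).elim ⊥ (subtypeBotEmb _))
    else (F₂.parent ⟨x, h⟩).map (subtypeBotEmb _)
  acyclic := by
    obtain ⟨r₁, h₁⟩ := F₁.exists_rank
    obtain ⟨r₂, h₂⟩ := F₂.exists_rank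
    refine acyclic_of_rank (WithBot.recBotCoe 0 fun x =>
      if h : x ∈ A then r₁ ⟨x, h⟩ + 1 else r₂ ⟨x, h⟩ + 1) ?_
    intro a b
    induction b using WithBot.recBotCoe with
    | bot => simp
    | coe b =>
      by_cases hb : b ∈ A
      · cases hp : F₁.parent ⟨b, hb⟩ with
        | none => simp [hb, hp]; rintro rfl; simp
        | some c =>
          obtain ⟨c, hc⟩ := c
          have := h₁ _ _ hp
          simp [hb, hp]; rintro rfl; simpa [hc] using this
      · simp only [WithBot.recBotCoe_coe, hb, dite_false, Option.map_eq_some_iff]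
        rintro ⟨⟨c, hcA⟩, hc, rfl⟩
        have := h₂ _ _ hc
        simpa [hcA] using this

/-- Add to a forest on the complement of `v` a new component, consisting of the root `v` and
its child `⊥`. -/
noncomputable def hangBot (v : V) (F : RootedForest {x // x ≠ v}) :
    RootedForest (WithBot V) where
  parent := WithBot.recBotCoe (some v) fun x =>
    if h : x ≠ v then (F.parent ⟨x, h⟩).map (subtypeBotEmb _) else none
  acyclic := by
    obtain ⟨r, hr⟩ := F.exists_rank
    refine acyclic_of_rank (WithBot.recBotCoe 1 fun x => if h : x ≠ v then r ⟨x, h⟩ else 0) ?_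
    intro a b
    induction b using WithBot.recBotCoe with
    | bot => simp; rintro rfl; simp
    | coe b =>
      by_cases hb : b ≠ v
      · simp only [WithBot.recBotCoe_coe, hb, ne_eq, not_false_eq_true, dite_true,
          Option.map_eq_some_iff]
        rintro ⟨⟨c, hcv⟩, hc, rfl⟩
        have := hr _ _ hc
        simpa [hcv] using this
      · simp [hb]

variable {A : Finset V} {F₁ : RootedForest {x // x ∈ A}} {F₂ : RootedForest {x // x ∉ A}}

@[simp] theorem joinBot_parent_bot : (joinBot A F₁ F₂).parent ⊥ = none := rfl

theorem joinBot_parent_mem (x : {x // x ∈ A}) : (joinBot A F₁ F₂).parent ((x : V) : WithBot V) =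
    some ((F₁.parent x).elim ⊥ (subtypeBotEmb _)) := by
  simp [joinBot]

theorem joinBot_parent_notMem (x : {x // x ∉ A}) :
    (joinBot A F₁ F₂).parent ((x : V) : WithBot V) =
      (F₂.parent x).map (subtypeBotEmb _) := by
  have := x.2
  simp [joinBot, this]

variable {v : V} {F : RootedForest {x // x ≠ v}}

@[simp] theorem hangBot_parent_bot : (hangBot v F).parent ⊥ = some (v : WithBot V) := rfl

@[simp] theorem hangBot_parent_self : (hangBot v F).parent (v : WithBot V) = none := by
  simp [hangBot]

theorem hangBot_parent_ne (x : {x // x ≠ v}) : (hangBot v F).parent ((x : V) : WithBot V) =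
    (F.parent x).map (subtypeBotEmb _) := by
  have := x.2
  simp [hangBot, this]

/-- Only the last vertex of a chain matters: if it is `⊥`, which is a root, the whole chain is `⊥`;
otherwise the chain lies in the piece containing its last vertex, or starts at `⊥`. -/
theorem avoids_joinBot {S : Set Pattern} (hS : ∀ π ∈ S, ¬ π.StartsWithMin)
    (h₁ : F₁.Avoids S) (h₂ : F₂.Avoids S) : (joinBot A F₁ F₂).Avoids S := by
  rintro π hπ ⟨x, hanc, hx⟩
  generalize hl : x ⟨π.length - 1, Nat.sub_one_lt π.length_pos.ne'⟩ = l
  induction l using WithBot.recBotCoe with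
  | bot =>
    refine hS π hπ (Pattern.startsWithMin_of_eq_bot hx ?_)
    by_cases h1 : π.length = 1
    · rw [← hl]; congr 2; omega
    · have := hanc ⟨0, π.length_pos⟩ ⟨π.length - 1, Nat.sub_one_lt π.length_pos.ne'⟩
        (Fin.lt_def.2 (by have := π.length_pos; simp; omega))
      rw [hl] at this
      exact pred_of_isAncestor (P := (· = ⊥)) (by rintro c u rfl; simp) this rfl
  | coe l =>
    by_cases hlA : l ∈ A
    · refine h₁ π hπ (contains_of_last_mem (G := joinBot A F₁ F₂)
        (e := subtypeBotEmb (· ∈ A)) (P := (· = ⊥)) (fun c h => h) (by rintro c u rfl; simp)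
        (fun w u h => ?_) (hS π hπ) hanc hx (w := ⟨l, hlA⟩) hl)
      · change (joinBot A F₁ F₂).parent ((w : V) : WithBot V) = _ at h
        rw [joinBot_parent_mem] at h
        cases hp : F₁.parent w with
        | none => left; simpa [hp] using h.symm
        | some c => right; refine ⟨c, ?_, rfl⟩; simpa [hp] using h.symm
    · refine h₂ π hπ (contains_of_last_mem (G := joinBot A F₁ F₂)
        (e := subtypeBotEmb (· ∉ A)) (P := fun _ => False) (fun c h => h.elim)
        (fun c u h => h.elim)
        (fun w u h => ?_) (hS π hπ) hanc hx (w := ⟨l, hlA⟩) hl)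
      · change (joinBot A F₁ F₂).parent ((w : V) : WithBot V) = _ at h
        rw [joinBot_parent_notMem, Option.map_eq_some_iff] at h
        obtain ⟨c, hc, rfl⟩ := h
        exact Or.inr ⟨c, rfl, hc⟩

/-- A chain meeting the new component lies inside it, and the only pattern there not beginning with
its minimum is `21`, read from `v` down to `⊥`. -/
theorem avoids_hangBot {S : Set Pattern} (hS : ∀ π ∈ S, ¬ π.StartsWithMin)
    (h21 : Pattern.p21 ∉ S) (hF : F.Avoids S) : (hangBot v F).Avoids S := by
  rintro π hπ ⟨x, hanc, hx⟩
  have hinj : Function.Injective x := fun i j hij => by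
    rcases lt_trichotomy (π.perm i) (π.perm j) with h | h | h
    · exact absurd hij ((hx i j).2 h).ne
    · exact π.perm.injective h
    · exact absurd hij ((hx j i).2 h).ne'
  have hpos := π.length_pos
  generalize hl : x ⟨π.length - 1, Nat.sub_one_lt π.length_pos.ne'⟩ = l
  by_cases hlv : l = ⊥ ∨ l = v
  · have hall : ∀ i, x i = ⊥ ∨ x i = v := fun i => by
      by_cases hi : i = ⟨π.length - 1, Nat.sub_one_lt π.length_pos.ne'⟩
      · rw [hi, hl]; exact hlv
      · have := hanc i ⟨π.length - 1, Nat.sub_one_lt π.length_pos.ne'⟩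
          (lt_of_le_of_ne (Fin.le_def.2 (by simp; omega)) hi)
        rw [hl] at this
        refine pred_of_isAncestor (P := fun c : WithBot V => c = ⊥ ∨ c = v) ?_ this hlv
        rintro c u (rfl | rfl) h
        · simp at h; exact Or.inr h.symm
        · simp at h
    have h0 : x ⟨0, hpos⟩ = v := (hall _).resolve_left fun h =>
      hS π hπ (Pattern.startsWithMin_of_eq_bot hx h)
    have hother : ∀ i, i ≠ ⟨0, hpos⟩ → x i = ⊥ := fun i hi =>
      (hall i).resolve_right fun h => hi (hinj (h.trans h0.symm))
    obtain ⟨k, hk, p⟩ := π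
    dsimp only at *
    -- All vertices after the first equal `⊥`, and the vertices are distinct.
    have hk2 : k ≤ 2 := by
      by_contra! hk2
      have := hinj ((hother ⟨1, by omega⟩ (by simp)).trans (hother ⟨2, by omega⟩ (by simp)).symm)
      simp at this
    have hk1 : k ≠ 1 := by
      rintro rfl
      refine hS _ hπ ?_
      have := (Pattern.first ⟨1, hk, p⟩).2
      dsimp only at this
      simp only [Pattern.StartsWithMin]
      omega
    obtain rfl : k = 2 := by omega
    have hlt := (hx 1 0).1 (by
      rw [hother 1 (by simp)]
      change ⊥ < x ⟨0, hpos⟩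
      rw [h0]; exact WithBot.bot_lt_coe v)
    apply h21
    convert hπ using 1
    unfold Pattern.p21
    congr 1
    ext i
    have := (p 0).2
    have := (p 1).2
    rw [Fin.lt_def] at hlt
    fin_cases i <;> simp <;> omega
  · push Not at hlv
    obtain ⟨w, rfl⟩ := WithBot.ne_bot_iff_exists.1 hlv.1
    have hw : w ≠ v := fun h => hlv.2 (by rw [h])
    refine hF π hπ (contains_of_last_mem (G := hangBot v F)
        (e := subtypeBotEmb (· ≠ v)) (P := fun _ => False) (fun c h => h.elim)
        (fun c u h => h.elim)
        (fun w u h => ?_) (hS π hπ) hanc hx (w := ⟨w, hw⟩) hl)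
    · change (hangBot v F).parent ((w : V) : WithBot V) = _ at h
      rw [hangBot_parent_ne, Option.map_eq_some_iff] at h
      obtain ⟨c, hc, rfl⟩ := h
      exact Or.inr ⟨c, rfl, hc⟩

theorem isAncestor_bot_joinBot_iff {x : V} :
    (joinBot A F₁ F₂).IsAncestor ⊥ x ↔ x ∈ A := by
  constructor
  · intro h
    by_contra hx
    have key := ancestor_mem (G := joinBot A F₁ F₂) (e := subtypeBotEmb (· ∉ A)) (F := F₂)
      (w := ⟨x, hx⟩) (u := ⊥) (P := fun _ => False) (fun c u h => h.elim) (fun w u h => ?_) h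
    · obtain h' | ⟨w, h', _⟩ := key
      · exact h'
      · exact WithBot.bot_ne_coe h'
    · change (joinBot A F₁ F₂).parent ((w : V) : WithBot V) = _ at h
      rw [joinBot_parent_notMem, Option.map_eq_some_iff] at h
      obtain ⟨c, hc, rfl⟩ := h
      exact Or.inr ⟨c, rfl, hc⟩
  · obtain ⟨r, hr⟩ := F₁.exists_rank
    suffices ∀ n (y : {x // x ∈ A}), r y < n →
        (joinBot A F₁ F₂).IsAncestor ⊥ ((y : V) : WithBot V) from
      fun hx => this _ ⟨x, hx⟩ (Nat.lt_succ_self _)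
    intro n
    induction n with
    | zero => intro y hy; omega
    | succ n ih =>
      intro y hy
      have hp := joinBot_parent_mem (F₁ := F₁) (F₂ := F₂) y
      cases h : F₁.parent y with
      | none => rw [h] at hp; exact Relation.ReflTransGen.single hp
      | some c =>
        rw [h] at hp
        exact Relation.ReflTransGen.tail (ih c (by have := hr _ _ h; omega)) hp

/-- `A` is recovered as the set of proper descendants of `⊥`, after which the parent maps can be
compared piece by piece. -/
theorem joinBot_injective : Function.Injective
    (fun x : (Σ A : Finset V, RootedForest {x // x ∈ A} × RootedForest {x // x ∉ A}) =>
      joinBot x.1 x.2.1 x.2.2) := by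
  rintro ⟨A, F₁, F₂⟩ ⟨A', F₁', F₂'⟩ h
  dsimp only at h
  obtain rfl : A = A' := by
    ext x
    rw [← isAncestor_bot_joinBot_iff (F₁ := F₁) (F₂ := F₂), h, isAncestor_bot_joinBot_iff]
  have h1 : F₁ = F₁' := by
    ext1; funext x
    have hp := joinBot_parent_mem (F₁ := F₁) (F₂ := F₂) x
    rw [h, joinBot_parent_mem] at hp
    have hp := Option.some_injective _ hp
    cases h1 : F₁.parent x <;> cases h2 : F₁'.parent x <;> rw [h1, h2] at hp
    · exact absurd hp.symm WithBot.bot_ne_coe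
    · exact absurd hp WithBot.bot_ne_coe
    · exact congrArg some ((subtypeBotEmb _).injective hp.symm)
  have h2 : F₂ = F₂' := by
    ext1; funext x
    have hp := joinBot_parent_notMem (F₁ := F₁) (F₂ := F₂) x
    rw [h, joinBot_parent_notMem] at hp
    exact (Option.map_injective (subtypeBotEmb _).injective hp).symm
  rw [h1, h2]

theorem hangBot_injective : Function.Injective
    (fun x : (Σ v : V, RootedForest {x // x ≠ v}) => hangBot x.1 x.2) := by
  rintro ⟨v, F⟩ ⟨v', F'⟩ h
  dsimp only at h
  obtain rfl : v = v' := by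
    have := congrArg (fun G => G.parent ⊥) h
    simpa using this
  have h2 : F = F' := by
    ext1; funext x
    have hp := hangBot_parent_ne (F := F) x
    rw [h, hangBot_parent_ne] at hp
    exact (Option.map_injective (subtypeBotEmb _).injective hp).symm
  rw [h2]

end Construct

end RootedForest

/-! ### Counting the glued forests -/

namespace RootedForest

theorem card_sigma_join (S : Set Pattern) (n : ℕ) :
    Nat.card (Σ A : Finset (Fin n), {F : RootedForest {x // x ∈ A} // F.Avoids S} ×
      {F : RootedForest {x // x ∉ A} // F.Avoids S}) =
    ∑ m ∈ Finset.range (n + 1), n.choose m * (forestCount S m * forestCount S (n - m)) := by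
  rw [Nat.card_sigma]
  have h : ∀ A : Finset (Fin n), Nat.card ({F : RootedForest {x // x ∈ A} // F.Avoids S} ×
      {F : RootedForest {x // x ∉ A} // F.Avoids S}) =
      forestCount S A.card * forestCount S (n - A.card) := fun A => by
    rw [Nat.card_prod, card_avoids_eq_forestCount S {x // x ∈ A} (Fintype.card_coe A),
      card_avoids_eq_forestCount S {x // x ∉ A} (n := n - A.card) (by
        rw [Fintype.card_subtype_compl]; simp)]
  simp only [h]
  have := Finset.sum_powerset_apply_card (fun m => forestCount S m * forestCount S (n - m))
    (x := (Finset.univ : Finset (Fin n)))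
  simpa using this

theorem card_sigma_hang (S : Set Pattern) (n : ℕ) :
    Nat.card (Σ v : Fin n, {F : RootedForest {x // x ≠ v} // F.Avoids S}) =
      n * forestCount S (n - 1) := by
  rw [Nat.card_sigma]
  have h : ∀ v : Fin n, Nat.card {F : RootedForest {x // x ≠ v} // F.Avoids S} =
      forestCount S (n - 1) := fun v => card_avoids_eq_forestCount S {x // x ≠ v} (by
        rw [Fintype.card_subtype_compl]; simp)
  simp [h]

/-- The avoiding forests obtained by gluing. -/
noncomputable def joinAvoiding {S : Set Pattern} (hS : ∀ π ∈ S, ¬ π.StartsWithMin) (n : ℕ)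
    (x : Σ A : Finset (Fin n), {F : RootedForest {x // x ∈ A} // F.Avoids S} ×
      {F : RootedForest {x // x ∉ A} // F.Avoids S}) :
    {F : RootedForest (WithBot (Fin n)) // F.Avoids S} :=
  ⟨joinBot x.1 x.2.1.1 x.2.2.1, avoids_joinBot hS x.2.1.2 x.2.2.2⟩

theorem joinAvoiding_injective {S : Set Pattern} (hS : ∀ π ∈ S, ¬ π.StartsWithMin) (n : ℕ) :
    Function.Injective (joinAvoiding hS n) := by
  rintro ⟨A, F₁, F₂⟩ ⟨A', F₁', F₂'⟩ h
  have := @joinBot_injective (Fin n) _ _ ⟨A, F₁.1, F₂.1⟩ ⟨A', F₁'.1, F₂'.1⟩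
    (congrArg Subtype.val h)
  simp only [Sigma.mk.injEq] at this
  obtain ⟨rfl, h2⟩ := this
  have h2 := eq_of_heq h2
  simp only [Prod.mk.injEq] at h2
  rw [Subtype.ext h2.1, Subtype.ext h2.2]

/-- The avoiding forests with a component consisting of a root and its smaller child `⊥`. -/
noncomputable def hangAvoiding {S : Set Pattern} (hS : ∀ π ∈ S, ¬ π.StartsWithMin)
    (h21 : Pattern.p21 ∉ S) (n : ℕ)
    (x : Σ v : Fin n, {F : RootedForest {x // x ≠ v} // F.Avoids S}) :
    {F : RootedForest (WithBot (Fin n)) // F.Avoids S} :=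
  ⟨hangBot x.1 x.2.1, avoids_hangBot hS h21 x.2.2⟩

theorem hangAvoiding_injective {S : Set Pattern} (hS : ∀ π ∈ S, ¬ π.StartsWithMin)
    (h21 : Pattern.p21 ∉ S) (n : ℕ) : Function.Injective (hangAvoiding hS h21 n) := by
  rintro ⟨v, F⟩ ⟨v', F'⟩ h
  have := @hangBot_injective (Fin n) _ _ ⟨v, F.1⟩ ⟨v', F'.1⟩ (congrArg Subtype.val h)
  simp only [Sigma.mk.injEq] at this
  obtain ⟨rfl, h2⟩ := this
  rw [Subtype.ext (eq_of_heq h2)]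

theorem card_withBot_fin (n : ℕ) : Fintype.card (WithBot (Fin n)) = n + 1 := by
  exact (Fintype.card_option (α := Fin n)).trans (by rw [Fintype.card_fin])

end RootedForest

open RootedForest

theorem sum_le_forestCount_succ {S : Set Pattern} (hS : ∀ π ∈ S, ¬ π.StartsWithMin) (n : ℕ) :
    ∑ m ∈ Finset.range (n + 1), n.choose m * (forestCount S m * forestCount S (n - m)) ≤
      forestCount S (n + 1) := by
  rw [← card_sigma_join, ← card_avoids_eq_forestCount S (WithBot (Fin n)) (card_withBot_fin n)]
  exact Nat.card_le_card_of_injective _ (joinAvoiding_injective hS n)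

theorem sum_add_le_forestCount_succ {S : Set Pattern} (hS : ∀ π ∈ S, ¬ π.StartsWithMin)
    (h21 : Pattern.p21 ∉ S) (n : ℕ) :
    ∑ m ∈ Finset.range (n + 1), n.choose m * (forestCount S m * forestCount S (n - m)) +
      n * forestCount S (n - 1) ≤ forestCount S (n + 1) := by
  rw [← card_sigma_join, ← card_sigma_hang, ← Nat.card_sum,
    ← card_avoids_eq_forestCount S (WithBot (Fin n)) (card_withBot_fin n)]
  refine Nat.card_le_card_of_injective (Sum.elim (joinAvoiding hS n) (hangAvoiding hS h21 n))
    ((joinAvoiding_injective hS n).sumElim (hangAvoiding_injective hS h21 n) fun x y h => ?_)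
  -- The two families are disjoint: `⊥` is a root in the first and has a parent in the second.
  have := congrArg (fun G => G.1.parent ⊥) h
  simp [joinAvoiding, hangAvoiding] at this

/-! ### Upper bounds for the count -/

theorem forestCount_zero {S : Set Pattern} : forestCount S 0 = 1 := by
  rw [forestCount, Nat.card_eq_one_iff_unique]
  refine ⟨⟨fun F G => Subtype.ext (RootedForest.ext (funext fun x => x.elim0))⟩,
    ⟨⟨⟨fun _ => none, fun v => v.elim0⟩, ?_⟩⟩⟩
  rintro π _ ⟨v, -⟩
  exact (v ⟨0, π.length_pos⟩).elim0

theorem forestCount_le (S : Set Pattern) (n : ℕ) : forestCount S n ≤ (n + 1) ^ n := by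
  refine (Finite.card_subtype_le _).trans ((Nat.card_le_card_of_injective
    (RootedForest.parent : RootedForest (Fin n) → Fin n → Option (Fin n))
    fun _ _ h => RootedForest.ext h).trans ?_)
  simp [Nat.card_eq_fintype_card]

theorem parent_lt_of_avoids {S : Set Pattern} (h21 : Pattern.p21 ∈ S) {n : ℕ}
    {F : RootedForest (Fin n)} (hF : F.Avoids S) {a b : Fin n} (h : F.parent b = some a) :
    a < b := by
  by_contra! hab
  rcases hab.eq_or_lt with rfl | hab
  · exact F.acyclic b (Relation.TransGen.single h)
  refine hF _ h21 ⟨![a, b], ?_, ?_⟩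
  · intro i j hij
    change Fin 2 at i j
    fin_cases i <;> fin_cases j <;> simp at hij ⊢
    exact Relation.ReflTransGen.single h
  · intro i j
    change Fin 2 at i j
    change _ ↔ Equiv.swap (0 : Fin 2) 1 i < Equiv.swap (0 : Fin 2) 1 j
    fin_cases i <;> fin_cases j
    · exact iff_of_false (lt_irrefl _) (lt_irrefl _)
    · exact iff_of_false hab.not_gt (by decide)
    · exact iff_of_true hab (by decide)
    · exact iff_of_false (lt_irrefl _) (lt_irrefl _)

/-- Parents have smaller labels, so vertex `v`, counted from 0, has at most `v + 1` choices: a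
smaller label or no parent. -/
theorem forestCount_le_factorial {S : Set Pattern} (h21 : Pattern.p21 ∈ S) (n : ℕ) :
    forestCount S n ≤ n.factorial := by
  have hcard : Nat.card ((v : Fin n) → Option (Fin v)) = n.factorial := by
    rw [Nat.card_pi]
    simp only [Nat.card_eq_fintype_card, Fintype.card_option, Fintype.card_fin]
    rw [Fin.prod_univ_eq_prod_range (fun i => i + 1) n, Finset.prod_range_add_one_eq_factorial]
  rw [← hcard]
  refine Nat.card_le_card_of_injective
    (fun F v => (F.1.parent v).pmap (fun a (ha : a < v) => (⟨a, ha⟩ : Fin v))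
      (fun a ha => parent_lt_of_avoids h21 F.2 ha)) fun F G h => ?_
  refine Subtype.ext (RootedForest.ext (funext fun v => ?_))
  have hv := congrFun h v
  ext a
  have key : ∀ F : {F : RootedForest (Fin n) // F.Avoids S}, ∀ a, F.1.parent v = some a ↔
      ∃ h : a < v, (F.1.parent v).pmap (fun a (ha : a < v) => (⟨a, ha⟩ : Fin v))
        (fun a ha => parent_lt_of_avoids h21 F.2 ha) = some ⟨a, h⟩ := by
    intro F a
    simp only [Option.pmap_eq_some_iff]
    constructor
    · intro h; exact ⟨parent_lt_of_avoids h21 F.2 h, a, parent_lt_of_avoids h21 F.2 h, h, rfl⟩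
    · rintro ⟨h, b, hb, hF, heq⟩
      have hv := congrArg Fin.val heq
      rw [hF, Fin.ext (show (a : ℕ) = b from hv)]
  dsimp only at hv
  rw [key, key, hv]

/-! ### Complementation symmetry -/

/-- The pattern with every letter `i` replaced by `k + 1 - i`. -/
def Pattern.compl (π : Pattern) : Pattern := ⟨π.length, π.length_pos, π.perm.trans Fin.revPerm⟩

theorem Pattern.compl_compl (π : Pattern) : π.compl.compl = π := by
  obtain ⟨k, hk, p⟩ := π
  simp only [Pattern.compl]
  congr 1
  ext i
  simp

theorem Pattern.compl_p12 : Pattern.p12.compl = Pattern.p21 := by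
  have h : (Equiv.refl (Fin 2)).trans Fin.revPerm = Equiv.swap 0 1 := by decide
  unfold Pattern.p12 Pattern.p21 Pattern.compl
  exact congrArg (Pattern.mk 2 Nat.two_pos) h

theorem Pattern.startsWithMin_compl {π : Pattern} : π.compl.StartsWithMin ↔ π.StartsWithMax := by
  have := π.first.2
  have h : (π.compl.first : ℕ) = π.length - (π.first + 1) := Fin.val_rev π.first
  rw [StartsWithMin, StartsWithMax, h]
  omega

theorem RootedForest.contains_compl {n : ℕ} {F : RootedForest (Fin n)} {π : Pattern}
    (h : F.Contains π) : (F.relabel Fin.revPerm).Contains π.compl := by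
  obtain ⟨v, h1, h2⟩ := h
  refine ⟨fun i => Fin.revPerm (v i), fun i j hij => ?_, fun i j => ?_⟩
  · exact (isAncestor_relabel _ _).2 (h1 i j hij)
  · change _ ↔ Fin.rev (π.perm i) < Fin.rev (π.perm j)
    simpa using h2 j i

theorem forestCount_le_compl (S : Set Pattern) (n : ℕ) :
    forestCount S n ≤ forestCount (Pattern.compl ⁻¹' S) n := by
  refine Nat.card_le_card_of_injective (fun F => ⟨F.1.relabel Fin.revPerm, fun π hπ hc => ?_⟩) ?_
  · have := contains_compl hc
    have h2 := relabel_symm_relabel (Fin.revPerm (n := n)) F.1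
    rw [Fin.revPerm_symm] at h2
    rw [h2] at this
    exact F.2 _ hπ this
  · intro F G h
    have := congrArg (fun H => H.1.relabel Fin.revPerm.symm) h
    dsimp only at this
    rw [relabel_symm_relabel, relabel_symm_relabel] at this
    exact Subtype.ext this

theorem forestCount_compl (S : Set Pattern) (n : ℕ) :
    forestCount (Pattern.compl ⁻¹' S) n = forestCount S n := by
  refine le_antisymm ((forestCount_le_compl _ n).trans_eq ?_) (forestCount_le_compl S n)
  rw [← Set.preimage_comp]
  congr 1
  ext π
  simp [Pattern.compl_compl]

/-! ### A Fekete lemma and the asymptotics of n! -/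

/-- Superadditivity for comparable indices gives superadditivity for multiples. -/
theorem mul_le_of_superadditive {w : ℕ → ℝ}
    (hw : ∀ m n, 1 ≤ m → 1 ≤ n → m ≤ 2 * n → n ≤ 2 * m → w m + w n ≤ w (m + n))
    {k : ℕ} (hk : 1 ≤ k) (q : ℕ) (hq : 1 ≤ q) : q * w k ≤ w (q * k) := by
  induction q using Nat.strong_induction_on with
  | _ q ih =>
    rcases hq.eq_or_lt with rfl | hq
    · simp
    -- Halving keeps the two parts within a factor 2 of each other.
    · obtain ⟨a, b, hab, ha, hb, h1, h2⟩ : ∃ a b, a + b = q ∧ 1 ≤ a ∧ 1 ≤ b ∧ a ≤ 2 * b ∧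
          b ≤ 2 * a := ⟨q / 2, q - q / 2, by omega, by omega, by omega, by omega, by omega⟩
      have e1 := ih a (by omega) ha
      have e2 := ih b (by omega) hb
      have e3 := hw (a * k) (b * k) (by nlinarith) (by nlinarith) (by nlinarith) (by nlinarith)
      rw [← hab, add_mul]
      push_cast
      linarith

/-- Fekete's lemma for sequences that are superadditive up to a logarithmic error. -/
theorem exists_tendsto_div_of_superadditive_log {u : ℕ → ℝ} (h0 : ∀ n, 0 ≤ u n)
    {C : ℝ} (hC : ∀ n : ℕ, u n ≤ C * (n + 1))
    (hu : ∀ m n : ℕ, u m + u n - Real.log (m + n + 1 : ℕ) ≤ u (m + n + 1)) :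
    ∃ ℓ, Tendsto (fun n : ℕ => u n / n) atTop (𝓝 ℓ) := by
  set c := Real.log 5 with hc
  -- The shift by one absorbs the extra vertex in `hu`; the subtracted terms absorb its logarithmic
  -- error when the indices are comparable.
  set w : ℕ → ℝ := fun n => u (n - 1) - Real.log n - c with hwdef
  have hw : ∀ m n, 1 ≤ m → 1 ≤ n → m ≤ 2 * n → n ≤ 2 * m → w m + w n ≤ w (m + n) := by
    intro m n hm hn h1 h2
    obtain ⟨m, rfl⟩ := Nat.exists_eq_add_of_le' hm
    obtain ⟨n, rfl⟩ := Nat.exists_eq_add_of_le' hn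
    have h := hu m n
    -- For indices x, y within a factor 2 of each other, (x + y)² ≤ (9/2) x y, so the constant 5
    -- suffices.
    have hlog : Real.log (m + n + 1 : ℕ) + Real.log ((m + 1 + (n + 1) : ℕ) : ℝ) ≤
        Real.log (m + 1 : ℕ) + Real.log (n + 1 : ℕ) + Real.log 5 := by
      rw [← Real.log_mul (by positivity) (by positivity),
        ← Real.log_mul (by positivity) (by positivity),
        ← Real.log_mul (by positivity) (by positivity)]
      refine Real.log_le_log (by positivity) ?_
      have h1' : ((m : ℝ) + 1) ≤ 2 * (n + 1) := by exact_mod_cast h1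
      have h2' : ((n : ℝ) + 1) ≤ 2 * (m + 1) := by exact_mod_cast h2
      push_cast
      nlinarith [mul_nonneg (sub_nonneg.2 h1') (sub_nonneg.2 h2')]
    simp only [hwdef]
    have e : m + 1 + (n + 1) - 1 = m + n + 1 := by omega
    rw [e, Nat.add_sub_cancel, Nat.add_sub_cancel]
    linarith
  have hlogdiv : Tendsto (fun n : ℕ => Real.log n / n) atTop (𝓝 0) :=
    (Real.isLittleO_log_id_atTop.tendsto_div_nhds_zero).comp tendsto_natCast_atTop_atTop
  have hlow : ∀ k : ℕ, 1 ≤ k → ∀ ε > 0, ∀ᶠ n : ℕ in atTop, w k / k - ε < u n / n := by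
    intro k hk ε hε
    have hkR : (0 : ℝ) < k := by exact_mod_cast hk
    have ht : Tendsto (fun n : ℕ => -|w k| / n - Real.log n / n) atTop (𝓝 (0 - 0)) :=
      (tendsto_const_div_atTop_nhds_zero_nat _).sub hlogdiv
    rw [sub_zero] at ht
    filter_upwards [ht.eventually (lt_mem_nhds (show -ε < 0 by linarith)),
      eventually_ge_atTop k] with n hn hnk
    have hn0 : (0 : ℝ) < n := by exact_mod_cast (show 0 < n by omega)
    have hq : 1 ≤ n / k := Nat.div_pos hnk hk
    have e1 := mul_le_of_superadditive hw hk (n / k) hq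
    have hqk : 1 ≤ n / k * k := Nat.mul_pos hq hk
    have hdm := Nat.div_add_mod' n k
    -- The indices are not comparable here, so `hu` itself is used; its single error `log n`
    -- vanishes after division by `n`.
    have e2 := hu (n / k * k - 1) (n % k)
    rw [show n / k * k - 1 + n % k + 1 = n by omega] at e2
    have e3 : w (n / k * k) ≤ u (n / k * k - 1) := by
      have := Real.log_natCast_nonneg (n / k * k)
      have : 0 ≤ c := Real.log_nonneg (by norm_num)
      simp only [hwdef]
      linarith
    have e4 := h0 (n % k)
    have hdmR : ((n / k : ℕ) : ℝ) * k + (n % k : ℕ) = n := by exact_mod_cast hdm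
    have hmod : ((n % k : ℕ) : ℝ) ≤ k := by exact_mod_cast (Nat.mod_lt n hk).le
    have e5 : w k / k * n - |w k| ≤ (n / k : ℕ) * w k := by
      have : w k / k * n = (n / k : ℕ) * w k + w k * ((n % k : ℕ) / k) := by
        rw [← hdmR]; field_simp
      have hfrac : ((n % k : ℕ) : ℝ) / k ≤ 1 := (div_le_one hkR).2 hmod
      have hfrac0 : 0 ≤ ((n % k : ℕ) : ℝ) / k := by positivity
      rw [this]
      nlinarith [abs_nonneg (w k), le_abs_self (w k)]
    have e6 : w k / k * n - |w k| - Real.log n ≤ u n := by linarith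
    calc w k / k - ε < w k / k + (-|w k| / n - Real.log n / n) := by linarith
      _ = (w k / k * n - |w k| - Real.log n) / n := by field_simp; ring
      _ ≤ u n / n := by gcongr
  have hup : ∀ n : ℕ, u n / n ≤ 2 * |C| := fun n => by
    rcases Nat.eq_zero_or_pos n with rfl | hn
    · simp
    · have hn1 : (1 : ℝ) ≤ n := by exact_mod_cast hn
      rw [div_le_iff₀ (by linarith)]
      nlinarith [hC n, le_abs_self C, abs_nonneg C]
  have hbdd : IsBoundedUnder (· ≤ ·) atTop (fun n : ℕ => u n / n) :=
    isBoundedUnder_of ⟨_, hup⟩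
  have hbdd' : IsBoundedUnder (· ≥ ·) atTop (fun n : ℕ => u n / n) :=
    isBoundedUnder_of ⟨0, fun n => div_nonneg (h0 n) n.cast_nonneg⟩
  set ℓ := liminf (fun n : ℕ => u n / n) atTop with hℓ
  have hle : ∀ k : ℕ, 1 ≤ k → w k / k ≤ ℓ := by
    intro k hk
    refine le_of_forall_sub_le fun ε hε => ?_
    exact le_liminf_of_le hbdd.isCoboundedUnder_ge ((hlow k hk ε hε).mono fun n hn => hn.le)
  refine ⟨ℓ, tendsto_of_le_liminf_of_limsup_le le_rfl ?_ hbdd hbdd'⟩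
  -- This is `hle` at `n + 1`, solved for `u n`.
  have hupper : ∀ᶠ n : ℕ in atTop, u n / n ≤
      ℓ + (ℓ / n + (Real.log n / n + Real.log 2 / n) + c / n) := by
    filter_upwards [eventually_ge_atTop 1] with n hn
    have hn0 : (0 : ℝ) < n := by exact_mod_cast hn
    have := hle (n + 1) (by omega)
    rw [div_le_iff₀ (by positivity)] at this
    simp only [hwdef, Nat.add_sub_cancel] at this
    have hl : Real.log ((n + 1 : ℕ) : ℝ) ≤ Real.log n + Real.log 2 := by
      rw [← Real.log_mul (by positivity) (by positivity)]
      refine Real.log_le_log (by positivity) ?_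
      have : (1 : ℝ) ≤ n := by exact_mod_cast hn
      push_cast; linarith
    rw [div_le_iff₀ hn0]
    have : (ℓ + (ℓ / n + (Real.log n / n + Real.log 2 / n) + c / n)) * n =
      ℓ * n + ℓ + Real.log n + Real.log 2 + c := by field_simp; ring
    push_cast at *
    linarith
  have ht : Tendsto (fun n : ℕ => ℓ + (ℓ / n + (Real.log n / n + Real.log 2 / n) + c / n)) atTop
      (𝓝 (ℓ + (0 + (0 + 0) + 0))) :=
    tendsto_const_nhds.add (((tendsto_const_div_atTop_nhds_zero_nat _).add
      (hlogdiv.add (tendsto_const_div_atTop_nhds_zero_nat _))).add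
        (tendsto_const_div_atTop_nhds_zero_nat _))
  simp only [add_zero] at ht
  calc limsup (fun n : ℕ => u n / n) atTop ≤ _ :=
        limsup_le_limsup hupper hbdd'.isCoboundedUnder_le ht.isBoundedUnder_le
    _ = ℓ := ht.limsup_eq

theorem tendsto_log_factorial_div_sub_log :
    Tendsto (fun n : ℕ => Real.log n.factorial / n - Real.log n) atTop (𝓝 (-1)) := by
  have hlogdiv : Tendsto (fun n : ℕ => Real.log n / n) atTop (𝓝 0) :=
    (Real.isLittleO_log_id_atTop.tendsto_div_nhds_zero).comp tendsto_natCast_atTop_atTop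
  have h1 : Tendsto (fun n : ℕ => Real.log (Stirling.stirlingSeq n) / n) atTop (𝓝 0) :=
    ((Real.continuousAt_log (by positivity)).tendsto.comp
      Stirling.tendsto_stirlingSeq_sqrt_pi).div_atTop tendsto_natCast_atTop_atTop
  have h2 := (h1.add ((hlogdiv.add (tendsto_const_div_atTop_nhds_zero_nat (Real.log 2))).const_mul
    (1 / 2))).sub_const 1
  simp only [add_zero, mul_zero, zero_sub] at h2
  refine h2.congr' ?_
  filter_upwards [eventually_ge_atTop 1] with n hn
  have hn0 : (0 : ℝ) < n := by exact_mod_cast hn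
  rw [Stirling.log_stirlingSeq_formula, Real.log_mul (by norm_num) hn0.ne',
    Real.log_div hn0.ne' (Real.exp_pos 1).ne', Real.log_exp]
  field_simp
  ring

/-- The number of avoiding forests on `n` vertices, divided by `n!`. -/
noncomputable def forestRatio (S : Set Pattern) (n : ℕ) : ℝ := forestCount S n / n.factorial

theorem choose_mul_div_factorial (S : Set Pattern) {n m : ℕ} (hm : m ∈ Finset.range (n + 1)) :
    ((n.choose m * (forestCount S m * forestCount S (n - m)) : ℕ) : ℝ) =
      n.factorial * (forestRatio S m * forestRatio S (n - m)) := by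
  have h : ((n.choose m * m.factorial * (n - m).factorial : ℕ) : ℝ) = n.factorial :=
    congrArg _ (Nat.choose_mul_factorial_mul_factorial (Nat.lt_succ_iff.1 (Finset.mem_range.1 hm)))
  have h1 : (m.factorial : ℝ) ≠ 0 := by positivity
  have h2 : ((n - m).factorial : ℝ) ≠ 0 := by positivity
  rw [← h]
  unfold forestRatio
  push_cast
  field_simp

theorem forestCount_succ_div_factorial (S : Set Pattern) (n : ℕ) :
    (forestCount S (n + 1) : ℝ) = n.factorial * ((n + 1) * forestRatio S (n + 1)) := by
  have h1 : (n.factorial : ℝ) ≠ 0 := by positivity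
  rw [forestRatio, Nat.factorial_succ]
  push_cast
  field_simp

theorem forestRatio_nonneg (S : Set Pattern) (n : ℕ) : 0 ≤ forestRatio S n := by
  unfold forestRatio; positivity

theorem forestRatio_zero (S : Set Pattern) : forestRatio S 0 = 1 := by
  simp [forestRatio, forestCount_zero]

theorem forestRatio_le_exp (S : Set Pattern) (n : ℕ) : forestRatio S n ≤ Real.exp (n + 1) := by
  -- The ratio (n+1)^n / n! is one term of the series for e^{n+1}.
  refine le_trans ?_ (Real.pow_div_factorial_le_exp (n + 1 : ℝ) (by positivity) n)
  unfold forestRatio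
  gcongr
  exact_mod_cast forestCount_le S n

/-! ### Growth of f_n / n! when no pattern begins with its minimum -/

section

variable {S : Set Pattern} (hS : ∀ π ∈ S, ¬ π.StartsWithMin)

include hS

theorem sum_forestRatio_le (n : ℕ) :
    ∑ m ∈ Finset.range (n + 1), forestRatio S m * forestRatio S (n - m) ≤
      (n + 1) * forestRatio S (n + 1) := by
  have h : (_ : ℝ) ≤ _ := Nat.cast_le.2 (sum_le_forestCount_succ hS n)
  rw [Nat.cast_sum, Finset.sum_congr rfl fun m hm => choose_mul_div_factorial S hm,
    ← Finset.mul_sum, forestCount_succ_div_factorial] at h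
  exact le_of_mul_le_mul_left h (by positivity)

theorem sum_forestRatio_add_le (h21 : Pattern.p21 ∉ S) (n : ℕ) :
    ∑ m ∈ Finset.range (n + 2), forestRatio S m * forestRatio S (n + 1 - m) + forestRatio S n ≤
      (n + 2) * forestRatio S (n + 2) := by
  have h : (_ : ℝ) ≤ _ := Nat.cast_le.2 (sum_add_le_forestCount_succ hS h21 (n + 1))
  have e : (((n + 1) * forestCount S n : ℕ) : ℝ) = (n + 1).factorial * forestRatio S n := by
    have h1 : (n.factorial : ℝ) ≠ 0 := by positivity
    rw [forestRatio, Nat.factorial_succ]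
    push_cast
    field_simp
  rw [Nat.cast_add, Nat.cast_sum, Finset.sum_congr rfl fun m hm => choose_mul_div_factorial S hm,
    ← Finset.mul_sum, forestCount_succ_div_factorial, Nat.add_sub_cancel, e, ← mul_add] at h
  have := le_of_mul_le_mul_left h (by positivity)
  push_cast at this
  linarith

theorem one_le_forestRatio (n : ℕ) : 1 ≤ forestRatio S n := by
  induction n using Nat.strong_induction_on with
  | _ n ih =>
    rcases n with _ | n
    · exact (forestRatio_zero S).ge
    · have h := sum_forestRatio_le hS n
      have h2 : ∑ m ∈ Finset.range (n + 1), (1 : ℝ) ≤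
          ∑ m ∈ Finset.range (n + 1), forestRatio S m * forestRatio S (n - m) :=
        Finset.sum_le_sum fun m hm => one_le_mul_of_one_le_of_one_le
          (ih m (Finset.mem_range.1 hm)) (ih _ (by omega))
      simp only [Finset.sum_const, Finset.card_range, nsmul_eq_mul, mul_one] at h2
      push_cast at h2
      exact le_of_mul_le_mul_left (by linarith) (show (0 : ℝ) < n + 1 by positivity)

/-- A single term of the convolution; its logarithm is the hypothesis of the Fekete lemma. -/
theorem forestRatio_mul_le (m n : ℕ) :
    forestRatio S m * forestRatio S n ≤ ((m + n + 1 : ℕ) : ℝ) * forestRatio S (m + n + 1) := by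
  have h := sum_forestRatio_le hS (m + n)
  have h2 := Finset.single_le_sum (s := Finset.range (m + n + 1))
    (f := fun i => forestRatio S i * forestRatio S (m + n - i))
    (fun i _ => mul_nonneg (forestRatio_nonneg S _) (forestRatio_nonneg S _))
    (Finset.mem_range.2 (show m < m + n + 1 by omega))
  simp only [Nat.add_sub_cancel_left] at h2
  push_cast at h ⊢
  linarith

/-- The exponent is `n + 1` so that a product of two inductive bounds in the convolution is exactly
the bound to be proved. The terms with an index 0 or 1 fall short of this, and the extra summand
from the hanging construction compensates. -/
theorem pow_le_forestRatio (h21 : Pattern.p21 ∉ S) (n : ℕ) (hn : 2 ≤ n) :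
    (11 / 10 : ℝ) ^ (n + 1) ≤ forestRatio S n := by
  have h0 := forestRatio_zero S
  have h1 := one_le_forestRatio hS 1
  induction n using Nat.strong_induction_on with
  | _ n ih =>
    obtain ⟨n, rfl⟩ := Nat.exists_eq_add_of_le' hn
    have h := sum_forestRatio_add_le hS h21 n
    rcases n with _ | _ | n
    · norm_num [Finset.sum_range_succ, h0] at h ⊢
      linarith
    · have h2 := ih 2 (by omega) le_rfl
      norm_num [Finset.sum_range_succ, h0] at h h2 ⊢
      nlinarith
    · set b : ℝ := 11 / 10 with hb
      have hbn : 0 < b ^ n := by positivity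
      have e1 := ih (n + 3) (by omega) (by omega)
      have e2 := ih (n + 2) (by omega) (by omega)
      have hmid : ∑ m ∈ Finset.range n, b ^ (n + 5) ≤ ∑ m ∈ Finset.range n,
          forestRatio S (m + 1 + 1) * forestRatio S (n + 2 + 1 - (m + 1 + 1)) := by
        refine Finset.sum_le_sum fun m hm => ?_
        have hm := Finset.mem_range.1 hm
        have := mul_le_mul (ih (m + 1 + 1) (by omega) (by omega))
          (ih (n + 2 + 1 - (m + 1 + 1)) (by omega) (by omega)) (by positivity)
          (forestRatio_nonneg S _)
        rwa [← pow_add, show m + 1 + 1 + 1 + (n + 2 + 1 - (m + 1 + 1) + 1) = n + 5 by omega]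
          at this
      have hsum : ∑ m ∈ Finset.range (n + 2 + 2),
          forestRatio S m * forestRatio S (n + 2 + 1 - m) =
          ∑ m ∈ Finset.range n,
            forestRatio S (m + 1 + 1) * forestRatio S (n + 2 + 1 - (m + 1 + 1)) +
          2 * forestRatio S (n + 3) + 2 * (forestRatio S 1 * forestRatio S (n + 2)) := by
        rw [Finset.sum_range_succ, Finset.sum_range_succ, Finset.sum_range_succ',
          Finset.sum_range_succ',
          show n + 2 + 1 - (n + 2 + 1) = 0 by omega, show n + 2 + 1 - (n + 2) = 1 by omega,
          show n + 2 + 1 - 0 = n + 3 by omega, show n + 2 + 1 - (0 + 1) = n + 2 by omega, h0]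
        ring
      rw [hsum] at h
      simp only [Finset.sum_const, Finset.card_range, nsmul_eq_mul] at hmid
      have h3 : forestRatio S (n + 2) ≤ forestRatio S 1 * forestRatio S (n + 2) :=
        le_mul_of_one_le_left (forestRatio_nonneg S _) h1
      have p3 : b ^ (n + 2 + 1) = b ^ n * b ^ 3 := by rw [← pow_add]
      have p4 : b ^ (n + 3 + 1) = b ^ n * b ^ 4 := by rw [← pow_add]
      have p5 : b ^ (n + 5) = b ^ n * b ^ 5 := by rw [← pow_add]
      have p5' : b ^ (n + 2 + 2 + 1) = b ^ n * b ^ 5 := by rw [← pow_add]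
      rw [p3] at e2
      rw [p4] at e1
      rw [p5] at hmid
      have hfin : ((n : ℝ) + 4) * (b ^ n * b ^ 5) ≤
          ((n : ℝ) + 4) * forestRatio S (n + 2 + 2) := by
        -- This amounts to 4b² ≤ 2b + 3. Without the extra summand it would be 4b² ≤ 2b + 2, which
        -- fails for every b > 1.
        have hc : 4 * (b ^ n * b ^ 5) ≤ 2 * (b ^ n * b ^ 4) + 3 * (b ^ n * b ^ 3) := by
          have : 4 * b ^ 5 ≤ 2 * b ^ 4 + 3 * b ^ 3 := by rw [hb]; norm_num
          nlinarith
        rw [show ((n + 1 + 1 : ℕ) : ℝ) + 2 = (n : ℝ) + 4 by push_cast; ring] at h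
        change _ + forestRatio S (n + 2) ≤ _ * forestRatio S (n + 2 + 2) at h
        linarith
      change b ^ (n + 2 + 2 + 1) ≤ _
      rw [p5']
      exact le_of_mul_le_mul_left hfin (by positivity)

theorem exists_tendsto_log_forestRatio :
    ∃ ℓ, Tendsto (fun n : ℕ => Real.log (forestRatio S n) / n) atTop (𝓝 ℓ) := by
  have hpos : ∀ n, 0 < forestRatio S n := fun n => one_pos.trans_le (one_le_forestRatio hS n)
  refine exists_tendsto_div_of_superadditive_log (C := 1)
    (fun n => Real.log_nonneg (one_le_forestRatio hS n)) (fun n => ?_) fun m n => ?_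
  · rw [one_mul, Real.log_le_iff_le_exp (hpos n)]
    exact forestRatio_le_exp S n
  · rw [sub_le_iff_le_add', ← Real.log_mul (hpos _).ne' (hpos _).ne',
      ← Real.log_mul (by positivity) (hpos _).ne']
    exact Real.log_le_log (mul_pos (hpos _) (hpos _)) (forestRatio_mul_le hS m n)

theorem isForestStanleyWilfLimit_exp {ℓ : ℝ}
    (h : Tendsto (fun n : ℕ => Real.log (forestRatio S n) / n) atTop (𝓝 ℓ)) :
    IsForestStanleyWilfLimit S (Real.exp (ℓ + -1)) := by
  refine ((Real.continuous_exp.tendsto _).comp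
    (h.add tendsto_log_factorial_div_sub_log)).congr' ?_
  filter_upwards [eventually_ge_atTop 1] with n hn
  have hn0 : (0 : ℝ) < n := by exact_mod_cast hn
  have hpos : 0 < forestRatio S n := one_pos.trans_le (one_le_forestRatio hS n)
  have hfac : (0 : ℝ) < n.factorial := by positivity
  have e : (forestCount S n : ℝ) = forestRatio S n * n.factorial := by
    unfold forestRatio; field_simp
  rw [e, Real.rpow_def_of_pos (mul_pos hpos hfac), Real.log_mul hpos.ne' hfac.ne',
    Function.comp_apply]
  conv_rhs => rw [← Real.exp_log hn0, ← Real.exp_sub, Real.exp_log hn0]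
  congr 1
  ring

theorem forest_stanley_wilf_of_not_startsWithMin :
    ∃ L : ℝ, IsForestStanleyWilfLimit S L ∧
      (L = Real.exp (-1) ↔ Pattern.p21 ∈ S) ∧ (Pattern.p21 ∉ S → Real.exp (-1) < L) := by
  obtain ⟨ℓ, hℓ⟩ := exists_tendsto_log_forestRatio hS
  have hgt : Pattern.p21 ∉ S → Real.exp (-1) < Real.exp (ℓ + -1) := fun h21 => by
    have hlog : 0 < Real.log (11 / 10) := Real.log_pos (by norm_num)
    have : Real.log (11 / 10) ≤ ℓ := by
      refine ge_of_tendsto hℓ ?_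
      filter_upwards [eventually_ge_atTop 2] with n hn
      have hn0 : (0 : ℝ) < n := by exact_mod_cast (show 0 < n by omega)
      rw [le_div_iff₀ hn0]
      have h := Real.log_le_log (by positivity) (pow_le_forestRatio hS h21 n hn)
      rw [Real.log_pow] at h
      push_cast at h
      linarith
    exact Real.exp_lt_exp.2 (by linarith)
  refine ⟨_, isForestStanleyWilfLimit_exp hS hℓ, ⟨fun h => ?_, fun h21 => ?_⟩, hgt⟩
  · by_contra h21
    exact (hgt h21).ne' h
  -- The factorial upper bound meets the general lower bound 1, so ℓ = 0.
  · have h1 : ∀ n, forestRatio S n = 1 := fun n => le_antisymm (by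
      rw [forestRatio, div_le_one (by positivity)]
      exact_mod_cast forestCount_le_factorial h21 n) (one_le_forestRatio hS n)
    simp only [h1, Real.log_one, zero_div] at hℓ
    rw [tendsto_nhds_unique hℓ tendsto_const_nhds, zero_add]

end

theorem proposition4p7 (S : Set Pattern) (hS : Pattern.Uncovered S) :
    ∃ L : ℝ, IsForestStanleyWilfLimit S L ∧
      (L = Real.exp (-1) ↔ Pattern.p12 ∈ S ∨ Pattern.p21 ∈ S) ∧
      (¬ (Pattern.p12 ∈ S ∨ Pattern.p21 ∈ S) → Real.exp (-1) < L) := by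
  have h12 : Pattern.p12.StartsWithMin := rfl
  have h21 : Pattern.p21.StartsWithMax := rfl
  by_cases hmin : ∃ π ∈ S, π.StartsWithMin
  -- Since S is uncovered, its complemented set has no pattern beginning with its minimum, and the
  -- counts agree.
  · have hmax : ∀ π ∈ S, ¬ π.StartsWithMax := fun π hπ h => hS ⟨hmin, π, hπ, h⟩
    obtain ⟨L, hL, hiff, hgt⟩ := forest_stanley_wilf_of_not_startsWithMin
      (S := Pattern.compl ⁻¹' S) fun π hπ h => hmax _ hπ
        (Pattern.startsWithMin_compl.1 (by rwa [Pattern.compl_compl]))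
    have hmem : Pattern.p12 ∈ S ∨ Pattern.p21 ∈ S ↔ Pattern.p21 ∈ Pattern.compl ⁻¹' S := by
      rw [Set.mem_preimage, ← Pattern.compl_p12, Pattern.compl_compl, Pattern.compl_p12]
      exact or_iff_left fun h => hmax _ h h21
    rw [hmem]
    refine ⟨L, ?_, hiff, hgt⟩
    simpa only [IsForestStanleyWilfLimit, forestCount_compl] using hL
  · push Not at hmin
    rw [or_iff_right fun h => hmin _ h h12]
    exact forest_stanley_wilf_of_not_startsWithMin hmin
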